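/- Let $(A,\mathfrak m)$ be a Cohen–Macaulay local ring, that is, a commutative Noetherian local ring with $\operatorname{depth} A=\dim A$. Call a finitely generated nonzero $A$-module $L$ maximal Cohen–Macaulay if $\operatorname{depth} L=\dim A$, where $\operatorname{depth} L$ is the supremum of the lengths of $L$-regular sequences contained in $\mathfrak m$. Let $N$ be a maximal Cohen–Macaulay $A$-module, and let $M$ be a finitely generated $A$-module with $\operatorname{Hom}_A(M,N)\neq 0$ and $\operatorname{Ext}^i_A(M,N)=0$ for all $i>0$. Then $\operatorname{Hom}_A(M,N)$ is a maximal Cohen–Macaulay $A$-module. -/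

import Mathlib

universe u v

/-- The depth of a module `M` over a local ring `A`: the supremum of the lengths of the
`M`-regular sequences contained in the maximal ideal of `A`. -/
noncomputable def moduleDepth (A : Type u) [CommRing A] [IsLocalRing A]
    (M : Type v) [AddCommGroup M] [Module A M] : ℕ∞ :=
  sSup {n : ℕ∞ | ∃ rs : List A, (∀ r ∈ rs, r ∈ IsLocalRing.maximalIdeal A) ∧
    RingTheory.Sequence.IsRegular M rs ∧ (rs.length : ℕ∞) = n}

/-- A Cohen–Macaulay local ring: a Noetherian local ring whose depth equals its Krull dimension. -/
structure IsCohenMacaulayLocalRing (A : Type u) [CommRing A] [IsLocalRing A] : Prop where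
  isNoetherianRing : IsNoetherianRing A
  depth_eq : (moduleDepth A A : WithBot ℕ∞) = ringKrullDim A

/-- A maximal Cohen–Macaulay module over a local ring `A`: a nonzero finitely generated module
whose depth equals the Krull dimension of `A`. -/
structure IsMaximalCohenMacaulay (A : Type u) [CommRing A] [IsLocalRing A]
    (M : Type v) [AddCommGroup M] [Module A M] : Prop where
  finite : Module.Finite A M
  nontrivial : Nontrivial M
  depth_eq : (moduleDepth A M : WithBot ℕ∞) = ringKrullDim A

open CategoryTheory Abelian RingTheory.Sequence IsLocalRing
open scoped Pointwise

section Ext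

variable {R : Type u} [CommRing R]

/-! For `x` regular on `N`, the sequence `0 → N → N → N/xN → 0` and the vanishing of Ext give
`Hom(M,N)/x ≅ Hom(M,N/xN)`, and the vanishing passes to `N/xN`. By induction every `N`-regular
sequence in the maximal ideal is regular on `Hom(M,N)`, so its depth is at least `depth N = dim A`;
the dimension bounds it above. -/

/-- If `x` is a nonzerodivisor on `N`, a linear map into `N` whose values lie in `xN` is itself a
multiple of `x`. -/
theorem LinearMap.ker_compRight_mkQ_smul_top {M N : Type v} [AddCommGroup M] [Module R M]
    [AddCommGroup N] [Module R N] {x : R} (hx : IsSMulRegular N x) :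
    LinearMap.ker (LinearMap.compRight R (x • (⊤ : Submodule R N)).mkQ : (M →ₗ[R] N) →ₗ[R] _) =
      x • (⊤ : Submodule R (M →ₗ[R] N)) := by
  ext f
  rw [LinearMap.mem_ker, Submodule.mem_smul_pointwise_iff_exists]
  constructor
  · intro hf
    have hf' : ∀ m, ∃ n, x • n = f m := fun m ↦ by
      have h : (x • (⊤ : Submodule R N)).mkQ (f m) = 0 := LinearMap.congr_fun hf m
      rw [Submodule.mkQ_apply, Submodule.Quotient.mk_eq_zero,
        Submodule.mem_smul_pointwise_iff_exists] at h
      obtain ⟨n, -, hn⟩ := h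
      exact ⟨n, hn⟩
    choose g hg using hf'
    refine ⟨⟨⟨g, fun a b ↦ hx ?_⟩, fun r a ↦ hx ?_⟩, trivial, LinearMap.ext hg⟩
    · simp [hg]
    · simp [hg, smul_comm x r]
  · rintro ⟨g, -, rfl⟩
    ext m
    simp only [LinearMap.compRight_apply, LinearMap.comp_apply, Submodule.mkQ_apply,
      LinearMap.smul_apply, LinearMap.zero_apply, Submodule.Quotient.mk_eq_zero]
    exact Submodule.smul_mem_pointwise_smul _ _ _ trivial

variable [Small.{v} R]

/-- The obstruction to lifting a map along `N → N/xN` lies in `Ext¹(M,N)`. -/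
theorem LinearMap.compRight_mkQ_surjective_of_subsingleton_ext {M N : Type v} [AddCommGroup M]
    [Module R M] [AddCommGroup N] [Module R N] {x : R} (hx : IsSMulRegular N x)
    (h : Subsingleton (Ext (ModuleCat.of R M) (ModuleCat.of R N) 1)) :
    Function.Surjective
      (LinearMap.compRight R (x • (⊤ : Submodule R N)).mkQ : (M →ₗ[R] N) →ₗ[R] _) := by
  intro f
  have hx' : IsSMulRegular (ModuleCat.of R N) x := hx
  obtain ⟨g, hg⟩ := Ext.covariant_sequence_exact₃ (ModuleCat.of R M)
    hx'.smulShortComplex_shortExact (Ext.mk₀ (ModuleCat.ofHom f)) (zero_add 1)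
    (h.elim _ _)
  obtain ⟨g, rfl⟩ := Ext.homEquiv₀.symm.surjective g
  refine ⟨g.hom, ?_⟩
  change (Ext.mk₀ g).comp _ _ = _ at hg
  rw [Ext.mk₀_comp_mk₀] at hg
  exact congrArg ModuleCat.Hom.hom (Ext.homEquiv₀.symm.injective hg)

/-- In the long exact sequence, `Ext^i(M,N/xN)` sits between `Ext^i(M,N)` and `Ext^(i+1)(M,N)`. -/
theorem subsingleton_ext_quotSMulTop {M N : Type v} [AddCommGroup M] [Module R M]
    [AddCommGroup N] [Module R N] {x : R} (hx : IsSMulRegular N x) {i : ℕ}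
    (h₀ : Subsingleton (Ext (ModuleCat.of R M) (ModuleCat.of R N) i))
    (h₁ : Subsingleton (Ext (ModuleCat.of R M) (ModuleCat.of R N) (i + 1))) :
    Subsingleton (Ext (ModuleCat.of R M) (ModuleCat.of R (QuotSMulTop x N)) i) := by
  have hx' : IsSMulRegular (ModuleCat.of R N) x := hx
  refine subsingleton_of_forall_eq 0 fun f ↦ ?_
  obtain ⟨g, rfl⟩ := Ext.covariant_sequence_exact₃ (ModuleCat.of R M)
    hx'.smulShortComplex_shortExact f rfl (h₁.elim _ _)
  obtain rfl : g = 0 := h₀.elim _ _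
  apply Ext.zero_comp

/-- Weak regularity keeps the induction free of nonvanishing conditions on the quotients. -/
theorem isWeaklyRegular_linearMap_of_subsingleton_ext {M N : Type v} [AddCommGroup M]
    [Module R M] [AddCommGroup N] [Module R N] {rs : List R} (hrs : IsWeaklyRegular N rs)
    (h : ∀ i : ℕ, 0 < i → Subsingleton (Ext (ModuleCat.of R M) (ModuleCat.of R N) i)) :
    IsWeaklyRegular (M →ₗ[R] N) rs := by
  induction rs generalizing N with
  | nil => exact .nil R _
  | cons x rs ih =>
    rw [isWeaklyRegular_cons_iff] at hrs ⊢
    obtain ⟨hx, hrs⟩ := hrs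
    refine ⟨fun f g hfg ↦ LinearMap.ext fun m ↦ hx (LinearMap.congr_fun hfg m), ?_⟩
    -- The induction hypothesis is applied to `N/xN`, through `Hom(M,N)/x ≅ Hom(M,N/xN)`.
    refine (LinearEquiv.isWeaklyRegular_congr ?_ rs).mpr (ih hrs fun i hi ↦
      subsingleton_ext_quotSMulTop hx (h i hi) (h (i + 1) i.succ_pos))
    exact (Submodule.quotEquivOfEq _ _ (LinearMap.ker_compRight_mkQ_smul_top hx).symm).trans
      (LinearMap.quotKerEquivOfSurjective _
        (LinearMap.compRight_mkQ_surjective_of_subsingleton_ext hx (h 1 one_pos)))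

end Ext

/-- A regular sequence lowers the support dimension by exactly its length, and the quotient, being
nonzero, has dimension at least 0. -/
theorem moduleDepth_le_ringKrullDim (A : Type u) [CommRing A] [IsLocalRing A] [IsNoetherianRing A]
    (M : Type v) [AddCommGroup M] [Module A M] [Module.Finite A M] :
    (moduleDepth A M : WithBot ℕ∞) ≤ ringKrullDim A := by
  obtain ⟨d, hd⟩ := WithBot.ne_bot_iff_exists.mp (ringKrullDim_ne_bot (R := A))
  rw [← hd, WithBot.coe_le_coe]
  refine sSup_le ?_
  rintro _ ⟨rs, -, hrs, rfl⟩
  rw [← WithBot.coe_le_coe, hd]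
  have := hrs.quot_ofList_smul_nontrivial ⊤
  have := (Module.nonempty_support_of_nontrivial (R := A)
    (M := M ⧸ Ideal.ofList rs • (⊤ : Submodule A M))).to_subtype
  have hdim := Module.supportDim_add_length_eq_supportDim_of_isRegular rs hrs
  calc ((rs.length : ℕ∞) : WithBot ℕ∞) = 0 + (rs.length : WithBot ℕ∞) := by simp
    _ ≤ Module.supportDim A (M ⧸ Ideal.ofList rs • (⊤ : Submodule A M)) + rs.length :=
      add_le_add_left Order.krullDim_nonneg _
    _ = Module.supportDim A M := hdim
    _ ≤ ringKrullDim A := Module.supportDim_le_ringKrullDim A M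

theorem moduleDepth_le_moduleDepth_linearMap (A : Type u) [CommRing A] [IsLocalRing A]
    [IsNoetherianRing A] [Small.{v} A] (M N : Type v) [AddCommGroup M] [Module A M]
    [AddCommGroup N] [Module A N] [Module.Finite A M] [Module.Finite A N]
    [Nontrivial (M →ₗ[A] N)]
    (h : ∀ i : ℕ, 0 < i → Subsingleton (Ext (ModuleCat.of A M) (ModuleCat.of A N) i)) :
    moduleDepth A N ≤ moduleDepth A (M →ₗ[A] N) := by
  refine sSup_le_sSup ?_
  rintro _ ⟨rs, hmem, hrs, rfl⟩
  -- Nakayama upgrades weak regularity to regularity, as `Hom(M,N)` is finite and nonzero.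
  exact ⟨rs, hmem, .of_isWeaklyRegular_of_mem_maximalIdeal _ hmem
    (isWeaklyRegular_linearMap_of_subsingleton_ext hrs.1 h), rfl⟩

theorem theorem1p11 (A : Type u) [CommRing A] [IsLocalRing A] [Small.{v} A]
    (hA : IsCohenMacaulayLocalRing A)
    (M N : Type v) [AddCommGroup M] [Module A M] [AddCommGroup N] [Module A N]
    (hN : IsMaximalCohenMacaulay A N) (hM : Module.Finite A M)
    (hHom : Nontrivial (M →ₗ[A] N))
    (hExt : ∀ i : ℕ, 0 < i →
      Subsingleton (CategoryTheory.Abelian.Ext (ModuleCat.of A M) (ModuleCat.of A N) i)) :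
    IsMaximalCohenMacaulay A (M →ₗ[A] N) := by
  have := hA.isNoetherianRing
  have := hN.finite
  exact ⟨inferInstance, hHom, (moduleDepth_le_ringKrullDim A _).antisymm <| hN.depth_eq.symm.le.trans
    (WithBot.coe_le_coe.mpr (moduleDepth_le_moduleDepth_linearMap A M N hExt))⟩
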